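/- **Setting.** For $q\in[0,1/2]$ the balanced community modulated random recursive tree BCMRT$(q)$ is the following random growing tree. At time $1$ it is a single edge joining two nodes with time label $1$, one of type $A$ and one of type $B$. At each time $n\ge 2$, two new nodes with time label $n$, one of type $A$ and one of type $B$, are added to the existing tree on $2(n-1)$ nodes. Independently of each other, each new node selects its own type with probability $1-q$ and the other type with probability $q$, then chooses its parent uniformly among the $n-1$ existing nodes of the selected type, and is joined to it by an edge. After time $n$ the tree has $2n$ nodes. The *unrooted unlabelled* BCMRT$(q)$ is the isomorphism class of this tree as a graph: types, time labels and the initial edge are all forgotten. Let $P_q^{(n)}$ be its law. For $q_0<q_1$, a test is a function $\varphi$ from unrooted unlabelled trees on $2n$ nodes to $\{0,1\}$. Its risk and the optimal risk are $$\mathbf R_{q_0,q_1}(\varphi)=\tfrac12\Big(P_{q_0}^{(n)}(\varphi=1)+P_{q_1}^{(n)}(\varphi=0)\Big),\qquad \mathbf R^\star_{q_0,q_1}(n)=\inf_{\varphi}\mathbf R_{q_0,q_1}(\varphi),$$ where the infimum is over all tests. The total-variation distance is $d_{\mathrm{TV}}(P,Q)=\sup_E|P(E)-Q(E)|$, the supremum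 being over all events $E$. **Theorem.** For all $0\le q_0<q_1\le 1/2$, $$\sup_{n\ge 2}\mathbf R^\star_{q_0,q_1}(n)<\frac12,\qquad\text{and}\qquad \inf_{n\ge 2}d_{\mathrm{TV}}\big(P_{q_0}^{(n)},P_{q_1}^{(n)}\big)>0 .$$ -/

import Mathlib

noncomputable section

/-- The vertices of a BCMRT after `n` steps: `(i, true)` and `(i, false)` are the nodes of types
`A` and `B` whose time label is `i + 1`. -/
abbrev BCMRTNode (n : ℕ) : Type := Fin n × Bool

/-- A Bernoulli variable with parameter `q`: `true` with probability `q`, `false` with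
probability `1 - q`. -/
def coin (q : unitInterval) : PMF Bool :=
  PMF.ofFintype (fun b => if b then ENNReal.ofReal q else ENNReal.ofReal (1 - q)) (by
    have h0 : (0 : ℝ) ≤ q := q.2.1
    have h1 : (0 : ℝ) ≤ 1 - q := sub_nonneg.2 q.2.2
    simp [← ENNReal.ofReal_add h0 h1])

/-- The law of the parent of a new node of type `c`, in a tree with time labels `1, …, n + 1`.
With probability `q` the other type is selected, otherwise its own type; then the parent is
uniform among the existing nodes of the selected type. -/
def parentLaw (q : unitInterval) (n : ℕ) (c : Bool) : PMF (BCMRTNode (n + 1)) :=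
  (coin q).bind fun b =>
    (PMF.uniformOfFintype (Fin (n + 1))).map fun i => (i, if b then !c else c)

/-- The existing nodes, seen as nodes of the tree after one more step. -/
def nodeEmb (n : ℕ) : BCMRTNode n ↪ BCMRTNode (n + 1) where
  toFun v := (v.1.castSucc, v.2)
  inj' := by
    rintro ⟨i, c⟩ ⟨j, d⟩ h
    simpa using h

/-- Attach a new pair of nodes to `G`: the new node of type `A` to `u`, that of type `B` to `v`. -/
def attachPair {n : ℕ} (G : SimpleGraph (BCMRTNode n)) (u v : BCMRTNode n) :
    SimpleGraph (BCMRTNode (n + 1)) :=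
  G.map (nodeEmb n) ⊔ SimpleGraph.edge (Fin.last n, true) (nodeEmb n u)
    ⊔ SimpleGraph.edge (Fin.last n, false) (nodeEmb n v)

/-- The law of the fully labelled BCMRT with parameter `q`, with `2 * n` nodes. It starts (`n = 1`)
from one edge joining the two nodes of time label `1`, and at each step the two new nodes choose
their parents independently. The value at `n = 0` is the empty graph. -/
def bcmrt (q : unitInterval) : (n : ℕ) → PMF (SimpleGraph (BCMRTNode n))
  | 0 => PMF.pure ⊥
  | 1 => PMF.pure (SimpleGraph.edge (0, true) (0, false))
  | n + 2 =>
    (bcmrt q (n + 1)).bind fun G =>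
      (parentLaw q n true).bind fun u =>
        (parentLaw q n false).map fun v => attachPair G u v

/-- Graphs on the nodes, up to graph isomorphism (types, time labels and root edge are all
forgotten). -/
def shapeSetoid (n : ℕ) : Setoid (SimpleGraph (BCMRTNode n)) where
  r G H := Nonempty (G ≃g H)
  iseqv :=
    { refl := fun _ => ⟨SimpleGraph.Iso.refl⟩
      symm := fun ⟨e⟩ => ⟨e.symm⟩
      trans := fun ⟨e⟩ ⟨f⟩ => ⟨f.comp e⟩ }

/-- The unrooted unlabelled shapes on `2 * n` nodes: isomorphism classes of graphs. -/
def Shape (n : ℕ) : Type := Quotient (shapeSetoid n)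

/-- The law of the unrooted unlabelled BCMRT with parameter `q` and `2 * n` nodes. -/
def unlabelledBCMRT (q : unitInterval) (n : ℕ) : PMF (Shape n) :=
  (bcmrt q n).map (Quotient.mk (shapeSetoid n))

/-- The probability of the event `E` under the discrete law `P`, as a real number. -/
def eventProb {α : Type*} (P : PMF α) (E : Set α) : ℝ := (P.toOuterMeasure E).toReal

/-- The risk of a test `φ` of `H₀ : q = q₀` (answer `false`) against `H₁ : q = q₁`
(answer `true`): the average of the two error probabilities. -/
def risk (q₀ q₁ : unitInterval) (n : ℕ) (φ : Shape n → Bool) : ℝ :=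
  (1 / 2) * (eventProb (unlabelledBCMRT q₀ n) {t | φ t = true}
    + eventProb (unlabelledBCMRT q₁ n) {t | φ t = false})

/-- The optimal risk, over all tests that see only the unrooted unlabelled tree. -/
def optimalRisk (q₀ q₁ : unitInterval) (n : ℕ) : ℝ := ⨅ φ : Shape n → Bool, risk q₀ q₁ n φ

/-- The total-variation distance between two discrete laws. -/
def tvDist {α : Type*} (P Q : PMF α) : ℝ := ⨆ E : Set α, |eventProb P E - eventProb Q E|

end

/-!
The two laws are separated by one statistic of the unlabelled tree, the sum `T` of `z ^ d(x, y)`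
over the ordered pairs of nodes, with `z = 3 / 2`.

Since a new leaf sees the old nodes through its parent, one step further away, `T` changes by an
explicit amount at each step (`distSum_attachPair`). Let `N` be the number of nodes of each type and
`s = 1 - 2 * q` the correlation between the types of a node and its parent. The two parents together
are uniform, so the mean of `T` depends on `q` only through the distance between the two new nodes.
With `X` the sum over pairs of different types minus the sum over pairs of the same type,
* `E T' = E T * (1 + 2 * z / N) + 2 + z ^ 2 / (2 * N ^ 2) * (E T + s ^ 2 * E X)`,
* `E X' = E X * (1 + 2 * z * s / N) - 2 + z ^ 2 / (2 * N ^ 2) * (E T + s ^ 2 * E X)`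
(`meanDistSum_succ`, `meanCrossExcess_succ`). As `E X ≥ 0`, both means increase with `s`, and once
two values of `s` have produced a gap between the means of `T`, which happens at `N = 2`, this gap is
multiplied by at least `1 + 3 / N` at each step. So it is at least of order `N ^ 3`
(`cube_le_meanDistSum_gap`).

On the other hand `E (T ^ 2)` is at most of order `N ^ 6` (`second_moment_le`). The mean of the
increment of `T` accounts for a factor `1 + 6 / N + O(1 / N ^ 2)`. By Cauchy-Schwarz the second
moment of the increment is at most a constant times the mean of the same statistic with base
`z ^ 2 = 9 / 4`, which grows like `N ^ (9 / 2)`; what matters is that `9 / 2 < 5`, that is, that `z`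
is close enough to `1`.

Hence the gap is of the order of the standard deviations, and one more application of Cauchy-Schwarz
(`exists_event_separation`) gives events whose probabilities under the two laws differ by a constant
independent of `N`. Such events bound the total variation distance from below and the optimal risk
from above.
-/

/-! ### Expectations under finitely supported laws -/

/-- The expectation of a real function on a finite type under a discrete law. -/
noncomputable def pexp {α : Type*} [Fintype α] (p : PMF α) (f : α → ℝ) : ℝ :=
  ∑ a, (p a).toReal * f a

section Expectation

variable {α β : Type*} [Fintype α] [Fintype β]

lemma PMF.sum_toReal (p : PMF α) : ∑ a, (p a).toReal = 1 := by
  rw [← ENNReal.toReal_sum fun a _ => p.apply_ne_top a, ← tsum_fintype (L := .unconditional α),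
    p.tsum_coe, ENNReal.toReal_one]

lemma pexp_pure (a : α) (f : α → ℝ) : pexp (PMF.pure a) f = f a := by
  classical
  simp [pexp, PMF.pure_apply, apply_ite ENNReal.toReal]

lemma pexp_bind (p : PMF α) (g : α → PMF β) (f : β → ℝ) :
    pexp (p.bind g) f = pexp p fun a => pexp (g a) f := by
  have h : ∀ b, (p.bind g b).toReal = ∑ a, (p a).toReal * (g a b).toReal := fun b => by
    rw [PMF.bind_apply, tsum_fintype, ENNReal.toReal_sum fun a _ =>
      ENNReal.mul_ne_top (p.apply_ne_top a) ((g a).apply_ne_top b)]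
    simp [ENNReal.toReal_mul]
  simp only [pexp, h, Finset.sum_mul, Finset.mul_sum]
  rw [Finset.sum_comm]
  simp only [mul_assoc]

lemma pexp_map (p : PMF α) (g : α → β) (f : β → ℝ) :
    pexp (p.map g) f = pexp p fun a => f (g a) := by
  rw [← PMF.bind_pure_comp, pexp_bind]
  simp [pexp_pure]

lemma pexp_congr {p : PMF α} {f g : α → ℝ} (h : ∀ a ∈ p.support, f a = g a) :
    pexp p f = pexp p g := by
  refine Finset.sum_congr rfl fun a _ => ?_
  by_cases ha : p a = 0
  · simp [ha]
  · rw [h a ha]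

lemma pexp_mono {p : PMF α} {f g : α → ℝ} (h : ∀ a ∈ p.support, f a ≤ g a) :
    pexp p f ≤ pexp p g := by
  refine Finset.sum_le_sum fun a _ => ?_
  by_cases ha : p a = 0
  · simp [ha]
  · exact mul_le_mul_of_nonneg_left (h a ha) ENNReal.toReal_nonneg

lemma pexp_add (p : PMF α) (f g : α → ℝ) :
    (pexp p fun a => f a + g a) = pexp p f + pexp p g := by
  simp [pexp, mul_add, Finset.sum_add_distrib]

lemma pexp_sub (p : PMF α) (f g : α → ℝ) :
    (pexp p fun a => f a - g a) = pexp p f - pexp p g := by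
  simp [pexp, mul_sub, Finset.sum_sub_distrib]

lemma pexp_const_mul (p : PMF α) (c : ℝ) (f : α → ℝ) :
    (pexp p fun a => c * f a) = c * pexp p f := by
  simp [pexp, Finset.mul_sum, mul_left_comm]

lemma pexp_const (p : PMF α) (c : ℝ) : (pexp p fun _ => c) = c := by
  simp [pexp, ← Finset.sum_mul, PMF.sum_toReal]

end Expectation

/-! ### Separation of two laws by a statistic -/

lemma eventProb_nonneg {α : Type*} (p : PMF α) (E : Set α) : 0 ≤ eventProb p E :=
  ENNReal.toReal_nonneg

section Separation

variable {α : Type*} [Fintype α]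

lemma eventProb_eq_sum (p : PMF α) (E : Set α) [DecidablePred (· ∈ E)] :
    eventProb p E = ∑ a, if a ∈ E then (p a).toReal else 0 := by
  rw [eventProb, PMF.toOuterMeasure_apply_fintype, ENNReal.toReal_sum]
  · refine Finset.sum_congr rfl fun a _ => ?_
    by_cases h : a ∈ E <;> simp [h]
  · intro a _
    by_cases h : a ∈ E <;> simp [h, p.apply_ne_top a]

lemma eventProb_add_compl (p : PMF α) (E : Set α) : eventProb p E + eventProb p Eᶜ = 1 := by
  classical
  rw [eventProb_eq_sum, eventProb_eq_sum, ← Finset.sum_add_distrib, ← PMF.sum_toReal p]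
  refine Finset.sum_congr rfl fun a _ => ?_
  by_cases h : a ∈ E <;> simp [h]

lemma eventProb_le_one (p : PMF α) (E : Set α) : eventProb p E ≤ 1 := by
  linarith [eventProb_add_compl p E, eventProb_nonneg p Eᶜ]

/-- Two laws are separated as soon as some statistic has a difference of means of the same order as
its second moments: by Cauchy-Schwarz with the weights `|p a - q a|`, the event `{a | q a < p a}`
has noticeably different probabilities. -/
lemma exists_event_separation (p q : PMF α) (f : α → ℝ) :
    ∃ E : Set α, (pexp p f - pexp q f) ^ 2 ≤
      2 * ((pexp p fun a => f a ^ 2) + pexp q fun a => f a ^ 2) *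
        (eventProb p E - eventProb q E) := by
  classical
  set P : α → ℝ := fun a => (p a).toReal with hP
  set Q : α → ℝ := fun a => (q a).toReal with hQ
  have hP0 : ∀ a, 0 ≤ P a := fun a => ENNReal.toReal_nonneg
  have hQ0 : ∀ a, 0 ≤ Q a := fun a => ENNReal.toReal_nonneg
  have hsum : ∑ a, |P a - Q a| =
      2 * (eventProb p {a | Q a < P a} - eventProb q {a | Q a < P a}) := by
    have h1 : ∑ a, (P a - Q a) = 0 := by
      rw [Finset.sum_sub_distrib, hP, hQ, PMF.sum_toReal, PMF.sum_toReal, sub_self]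
    rw [eventProb_eq_sum, eventProb_eq_sum, ← Finset.sum_sub_distrib, Finset.mul_sum,
      ← sub_eq_zero, ← Finset.sum_sub_distrib, ← neg_eq_zero, ← h1, ← Finset.sum_neg_distrib]
    refine Finset.sum_congr rfl fun a _ => ?_
    by_cases h : Q a < P a
    · rw [abs_of_pos (sub_pos.2 h)]
      simp only [Set.mem_ofPred_eq, h, if_true]
      ring
    · rw [abs_of_nonpos (sub_nonpos.2 (not_lt.1 h))]
      simp [h]
  refine ⟨{a | Q a < P a}, ?_⟩
  have hcs := Finset.sum_mul_sq_le_sq_mul_sq Finset.univ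
    (fun a => Real.sqrt |P a - Q a| * |f a|) (fun a => Real.sqrt |P a - Q a|)
  have h1 : ∀ a, (Real.sqrt |P a - Q a| * |f a|) * Real.sqrt |P a - Q a| = |(P a - Q a) * f a| :=
    fun a => by
      rw [mul_right_comm, Real.mul_self_sqrt (abs_nonneg _), abs_mul]
  have h2 : ∀ a, (Real.sqrt |P a - Q a| * |f a|) ^ 2 = |P a - Q a| * f a ^ 2 := fun a => by
    rw [mul_pow, Real.sq_sqrt (abs_nonneg _), sq_abs]
  have h3 : ∀ a, Real.sqrt |P a - Q a| ^ 2 = |P a - Q a| := fun a => Real.sq_sqrt (abs_nonneg _)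
  simp only [h1, h2, h3] at hcs
  have h4 : ∑ a, |P a - Q a| * f a ^ 2 ≤ (pexp p fun a => f a ^ 2) + pexp q fun a => f a ^ 2 := by
    rw [pexp, pexp, ← Finset.sum_add_distrib]
    refine Finset.sum_le_sum fun a _ => ?_
    rw [← add_mul]
    refine mul_le_mul_of_nonneg_right ?_ (sq_nonneg _)
    have := hP0 a
    have := hQ0 a
    exact abs_le.2 ⟨by linarith, by linarith⟩
  have h5 : (pexp p f - pexp q f) ^ 2 ≤ (∑ a, |(P a - Q a) * f a|) ^ 2 := by
    rw [pexp, pexp, ← Finset.sum_sub_distrib]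
    simp only [← sub_mul]
    rw [← sq_abs]
    exact pow_le_pow_left₀ (abs_nonneg _) (Finset.abs_sum_le_sum_abs _ _) 2
  calc _ ≤ _ := h5.trans hcs
    _ ≤ _ := mul_le_mul_of_nonneg_right h4 (Finset.sum_nonneg fun a _ => abs_nonneg _)
    _ = _ := by rw [hsum]; ring

end Separation

/-! ### Distances after attaching a pair of leaves -/

/-- If `p` is the only neighbour of `a`, every path from `a` to another vertex starts with `p`. -/
lemma SimpleGraph.Connected.dist_eq_of_unique_neighbor {V : Type*} {G : SimpleGraph V}
    (hG : G.Connected) {a p : V} (hap : G.Adj a p) (huniq : ∀ y, G.Adj a y → y = p) {x : V}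
    (hx : x ≠ a) : G.dist a x = G.dist p x + 1 := by
  refine le_antisymm ?_ ?_
  · have := hG.dist_triangle (u := a) (v := p) (w := x)
    rw [SimpleGraph.dist_eq_one_iff_adj.2 hap] at this
    omega
  · obtain ⟨w, hw⟩ := hG.exists_walk_length_eq_dist a x
    rw [← hw]
    cases w with
    | nil => exact absurd rfl hx
    | cons h w' =>
      obtain rfl := huniq _ h
      simpa using SimpleGraph.dist_le w'

/-- A map that sends each edge to an edge or to a point does not increase distances. -/
lemma SimpleGraph.Connected.dist_le_of_contraction {V W : Type*} {G : SimpleGraph V}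
    {H : SimpleGraph W} (hG : G.Connected) (r : W → V)
    (hr : ∀ x y, H.Adj x y → r x = r y ∨ G.Adj (r x) (r y)) {x y : W} (w : H.Walk x y) :
    G.dist (r x) (r y) ≤ w.length := by
  induction w with
  | nil => simp
  | @cons a b c h w ih =>
    have h1 : G.dist (r a) (r b) ≤ 1 := by
      rcases hr _ _ h with h | h
      · simp [h]
      · exact (SimpleGraph.dist_eq_one_iff_adj.2 h).le
    have := hG.dist_triangle (u := r a) (v := r b) (w := r c)
    rw [SimpleGraph.Walk.length_cons]
    omega

/-- Every vertex of the larger tree is an old vertex or one of the two new ones. -/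
lemma BCMRTNode.cases_succ {n : ℕ} (x : BCMRTNode (n + 1)) :
    (∃ w, x = nodeEmb n w) ∨ x = (Fin.last n, true) ∨ x = (Fin.last n, false) := by
  obtain ⟨i, c⟩ := x
  induction i using Fin.lastCases with
  | last => cases c <;> simp
  | cast i => exact Or.inl ⟨(i, c), rfl⟩

lemma nodeEmb_ne_last {n : ℕ} (w : BCMRTNode n) (c : Bool) : nodeEmb n w ≠ (Fin.last n, c) := by
  intro h
  exact (Fin.castSucc_lt_last w.1).ne (congrArg Prod.fst h)

section AttachPair

variable {n : ℕ} {G : SimpleGraph (BCMRTNode n)} {u v : BCMRTNode n}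

lemma attachPair_adj_nodeEmb (x y : BCMRTNode n) :
    (attachPair G u v).Adj (nodeEmb n x) (nodeEmb n y) ↔ G.Adj x y := by
  simp [attachPair, SimpleGraph.edge_adj, nodeEmb_ne_last]

lemma attachPair_adj_last (c : Bool) (y : BCMRTNode (n + 1)) :
    (attachPair G u v).Adj (Fin.last n, c) y ↔ y = nodeEmb n (if c then u else v) := by
  cases c <;>
    simp [attachPair, SimpleGraph.edge_adj, SimpleGraph.map_adj, nodeEmb_ne_last,
      (nodeEmb_ne_last _ _).symm]
  all_goals
    rintro rfl
    exact (nodeEmb_ne_last _ _).symm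

lemma attachPair_connected (hG : G.Connected) : (attachPair G u v).Connected := by
  let φ : G →g attachPair G u v := ⟨nodeEmb n, fun h => (attachPair_adj_nodeEmb _ _).2 h⟩
  have key : ∀ x, (attachPair G u v).Reachable x (nodeEmb n u) := by
    have hold : ∀ w, (attachPair G u v).Reachable (nodeEmb n w) (nodeEmb n u) := fun w =>
      (hG.preconnected w u).map φ
    have hnew : ∀ c, (attachPair G u v).Reachable (Fin.last n, c) (nodeEmb n u) := fun c =>
      ((attachPair_adj_last c _).2 rfl).reachable.trans (hold _)
    intro x
    rcases BCMRTNode.cases_succ x with ⟨w, rfl⟩ | rfl | rfl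
    exacts [hold w, hnew _, hnew _]
  have : Nonempty (BCMRTNode (n + 1)) := ⟨nodeEmb n u⟩
  exact ⟨fun x y => (key x).trans (key y).symm⟩

lemma attachPair_dist_nodeEmb (hG : G.Connected) (x y : BCMRTNode n) :
    (attachPair G u v).dist (nodeEmb n x) (nodeEmb n y) = G.dist x y := by
  refine le_antisymm ?_ ?_
  · let φ : G →g attachPair G u v := ⟨nodeEmb n, fun h => (attachPair_adj_nodeEmb _ _).2 h⟩
    obtain ⟨w, hw⟩ := hG.exists_walk_length_eq_dist x y
    rw [← hw, ← SimpleGraph.Walk.length_map φ w]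
    exact SimpleGraph.dist_le (w.map φ)
  · -- Collapsing each new leaf onto its parent is a retraction onto the old tree.
    let r : BCMRTNode (n + 1) → BCMRTNode n := fun x =>
      Fin.lastCases (motive := fun _ => BCMRTNode n) (if x.2 then u else v) (fun i => (i, x.2)) x.1
    have rold : ∀ w, r (nodeEmb n w) = w := fun w => Fin.lastCases_castSucc _
    have rnew : ∀ c, r (Fin.last n, c) = if c then u else v := fun c => Fin.lastCases_last
    have hnew : ∀ c y, (attachPair G u v).Adj (Fin.last n, c) y → r (Fin.last n, c) = r y := by
      intro c y h
      rw [(attachPair_adj_last c y).1 h, rold, rnew]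
    have hr : ∀ x y, (attachPair G u v).Adj x y → r x = r y ∨ G.Adj (r x) (r y) := by
      intro x y h
      rcases BCMRTNode.cases_succ x with ⟨w, rfl⟩ | rfl | rfl
      · rcases BCMRTNode.cases_succ y with ⟨w', rfl⟩ | rfl | rfl
        · rw [rold, rold]
          exact Or.inr ((attachPair_adj_nodeEmb _ _).1 h)
        · exact Or.inl (hnew _ _ h.symm).symm
        · exact Or.inl (hnew _ _ h.symm).symm
      · exact Or.inl (hnew _ _ h)
      · exact Or.inl (hnew _ _ h)
    obtain ⟨w, hw⟩ := (attachPair_connected (u := u) (v := v) hG).exists_walk_length_eq_dist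
      (nodeEmb n x) (nodeEmb n y)
    have := hG.dist_le_of_contraction r hr w
    rwa [rold, rold, hw] at this

lemma attachPair_dist_last (hG : G.Connected) (c : Bool) (y : BCMRTNode n) :
    (attachPair G u v).dist (Fin.last n, c) (nodeEmb n y) = G.dist (if c then u else v) y + 1 := by
  rw [(attachPair_connected hG).dist_eq_of_unique_neighbor ((attachPair_adj_last c _).2 rfl)
    (fun y hy => (attachPair_adj_last c y).1 hy) (nodeEmb_ne_last y c),
    attachPair_dist_nodeEmb hG]

lemma attachPair_dist_last_last (hG : G.Connected) :
    (attachPair G u v).dist (Fin.last n, true) (Fin.last n, false) = G.dist u v + 2 := by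
  rw [(attachPair_connected hG).dist_eq_of_unique_neighbor ((attachPair_adj_last true _).2 rfl)
    (fun y hy => (attachPair_adj_last true y).1 hy) (by simp), SimpleGraph.dist_comm,
    attachPair_dist_last hG, SimpleGraph.dist_comm]
  simp

end AttachPair

lemma SimpleGraph.Iso.dist_apply {V W : Type*} {G : SimpleGraph V} {H : SimpleGraph W} (e : G ≃g H)
    (x y : V) : H.dist (e x) (e y) = G.dist x y := by
  by_cases h : G.Reachable x y
  · refine le_antisymm ?_ ?_
    · obtain ⟨w, hw⟩ := h.exists_walk_length_eq_dist
      rw [← hw, ← SimpleGraph.Walk.length_map e.toHom w]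
      exact SimpleGraph.dist_le (w.map e.toHom)
    · obtain ⟨w, hw⟩ := (e.reachable_iff.2 h).exists_walk_length_eq_dist
      rw [← hw, ← SimpleGraph.Walk.length_map e.symm.toHom w]
      simpa using SimpleGraph.dist_le (w.map e.symm.toHom)
  · rw [SimpleGraph.dist_eq_zero_of_not_reachable h,
      SimpleGraph.dist_eq_zero_of_not_reachable fun h' => h (e.reachable_iff.1 h')]

/-! ### Sums of powers of distances -/

/-- The sign of a type: `1` for type `A` and `-1` for type `B`. -/
def typeSign (c : Bool) : ℝ := if c then 1 else -1

/-- The correlation `1 - 2 * q` between the type of a new node and that of its parent. -/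
def typeCorr (q : unitInterval) : ℝ := 1 - 2 * q

/-- The sum of `z ^ d(x, y)` over the nodes `y`, weighted by their types through `ε`. -/
noncomputable def distSumFrom {n : ℕ} (ε : Bool → ℝ) (z : ℝ) (G : SimpleGraph (BCMRTNode n))
    (x : BCMRTNode n) : ℝ :=
  ∑ y, ε y.2 * z ^ G.dist x y

/-- The sum of `z ^ d(x, y)` over the ordered pairs of nodes, equal ones included, with weights
`ε x * ε y` depending on the types. For `ε = 1` this is an invariant of the unlabelled tree. -/
noncomputable def distSum {n : ℕ} (ε : Bool → ℝ) (z : ℝ) (G : SimpleGraph (BCMRTNode n)) : ℝ :=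
  ∑ x, ε x.2 * distSumFrom ε z G x

lemma distSum_eq_of_iso {n : ℕ} (z : ℝ) {G H : SimpleGraph (BCMRTNode n)} (e : G ≃g H) :
    distSum 1 z G = distSum 1 z H := by
  simp only [distSum, distSumFrom, Pi.one_apply, one_mul]
  rw [← e.toEquiv.sum_comp fun x => ∑ y, z ^ H.dist x y]
  refine Finset.sum_congr rfl fun x _ => ?_
  rw [← e.toEquiv.sum_comp fun y => z ^ H.dist (e.toEquiv x) y]
  exact Finset.sum_congr rfl fun y _ => by rw [← e.dist_apply x y]; rfl

lemma sum_bcmrtNode_succ {n : ℕ} (F : BCMRTNode (n + 1) → ℝ) :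
    ∑ x, F x = ∑ w, F (nodeEmb n w) + F (Fin.last n, true) + F (Fin.last n, false) := by
  rw [Fintype.sum_prod_type, Fin.sum_univ_castSucc, Fintype.sum_prod_type, Fintype.sum_bool,
    add_assoc]
  rfl

lemma nodeEmb_snd {n : ℕ} (w : BCMRTNode n) : (nodeEmb n w).2 = w.2 := rfl

/-- The two new leaves see the old nodes through their parents, one step further away. -/
lemma distSum_attachPair {n : ℕ} (ε : Bool → ℝ) (z : ℝ) {G : SimpleGraph (BCMRTNode n)}
    (hG : G.Connected) (u v : BCMRTNode n) :
    distSum ε z (attachPair G u v) = distSum ε z G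
      + 2 * z * (ε true * distSumFrom ε z G u + ε false * distSumFrom ε z G v)
      + 2 * z ^ 2 * (ε true * ε false) * z ^ G.dist u v + (ε true ^ 2 + ε false ^ 2) := by
  have hs : ∀ w, distSumFrom ε z (attachPair G u v) (nodeEmb n w) = distSumFrom ε z G w
      + z * (ε true * z ^ G.dist w u) + z * (ε false * z ^ G.dist w v) := fun w => by
    simp only [distSumFrom, sum_bcmrtNode_succ, attachPair_dist_nodeEmb hG,
      SimpleGraph.dist_comm (u := nodeEmb n w) (v := (Fin.last n, _)), attachPair_dist_last hG]
    simp only [SimpleGraph.dist_comm (u := w), if_true, Bool.false_eq_true, if_false, pow_succ]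
    simp only [nodeEmb_snd]
    ring
  have hnew : ∀ (c : Bool) p, p = (if c then u else v) →
      ∑ y, ε y.2 * z ^ (attachPair G u v).dist (Fin.last n, c) (nodeEmb n y)
        = z * distSumFrom ε z G p := fun c p hp => by
    rw [distSumFrom, Finset.mul_sum]
    refine Finset.sum_congr rfl fun y _ => ?_
    rw [attachPair_dist_last hG, hp, pow_succ]
    ring
  have hA : distSumFrom ε z (attachPair G u v) (Fin.last n, true) = z * distSumFrom ε z G u
      + ε true + ε false * (z ^ 2 * z ^ G.dist u v) := by
    rw [distSumFrom, sum_bcmrtNode_succ, ← hnew true u rfl, attachPair_dist_last_last hG, pow_add,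
      SimpleGraph.dist_self]
    simp only [nodeEmb_snd]
    ring
  have hB : distSumFrom ε z (attachPair G u v) (Fin.last n, false) = z * distSumFrom ε z G v
      + ε true * (z ^ 2 * z ^ G.dist u v) + ε false := by
    rw [distSumFrom, sum_bcmrtNode_succ, ← hnew false v rfl, SimpleGraph.dist_comm
      (u := (Fin.last n, false)) (v := (Fin.last n, true)), attachPair_dist_last_last hG, pow_add,
      SimpleGraph.dist_self]
    simp only [nodeEmb_snd]
    ring
  have hsum : ∀ p, ∑ w, ε w.2 * z ^ G.dist w p = distSumFrom ε z G p := fun p => by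
    simp only [distSumFrom, SimpleGraph.dist_comm (v := p)]
  have hold : ∑ w, ε (nodeEmb n w).2 * distSumFrom ε z (attachPair G u v) (nodeEmb n w)
      = distSum ε z G + z * (ε true * distSumFrom ε z G u)
        + z * (ε false * distSumFrom ε z G v) := by
    rw [← hsum u, ← hsum v, distSum]
    simp only [Finset.mul_sum, ← Finset.sum_add_distrib]
    refine Finset.sum_congr rfl fun w _ => ?_
    rw [hs]
    simp only [nodeEmb_snd]
    ring
  rw [distSum, sum_bcmrtNode_succ, hold, hA, hB]
  ring

section Bounds

variable {n : ℕ} {z : ℝ} (G : SimpleGraph (BCMRTNode n))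

lemma two_mul_le_distSumFrom (hz : 1 ≤ z) (x : BCMRTNode n) :
    (2 * n : ℝ) ≤ distSumFrom 1 z G x := by
  have : ∑ _y : BCMRTNode n, (1 : ℝ) ≤ ∑ y, z ^ G.dist x y :=
    Finset.sum_le_sum fun y _ => one_le_pow₀ hz
  simpa [distSumFrom, mul_comm] using this

lemma sq_le_distSum (hz : 1 ≤ z) : (4 * n ^ 2 : ℝ) ≤ distSum 1 z G := by
  have : ∑ _x : BCMRTNode n, (2 * n : ℝ) ≤ ∑ x, distSumFrom 1 z G x :=
    Finset.sum_le_sum fun x _ => two_mul_le_distSumFrom G hz x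
  simp only [Finset.sum_const, Finset.card_univ, Fintype.card_prod, Fintype.card_fin,
    Fintype.card_bool, nsmul_eq_mul] at this
  simp only [distSum, Pi.one_apply, one_mul]
  push_cast at this
  linarith

lemma pow_dist_le_distSumFrom (hz : 0 ≤ z) (x y : BCMRTNode n) :
    z ^ G.dist x y ≤ distSumFrom 1 z G x := by
  simp only [distSumFrom, Pi.one_apply, one_mul]
  exact Finset.single_le_sum (f := fun y => z ^ G.dist x y) (fun y _ => pow_nonneg hz _)
    (Finset.mem_univ y)

lemma distSumFrom_sq_le (z : ℝ) (x : BCMRTNode n) :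
    distSumFrom 1 z G x ^ 2 ≤ 2 * n * distSumFrom 1 (z ^ 2) G x := by
  have := sq_sum_le_card_mul_sum_sq (s := Finset.univ) (f := fun y => z ^ G.dist x y)
  simp only [distSumFrom, Pi.one_apply, one_mul]
  simp only [Finset.card_univ, Fintype.card_prod, Fintype.card_fin, Fintype.card_bool,
    ← pow_mul, mul_comm _ 2] at this
  simp only [pow_mul] at this
  exact_mod_cast this

lemma abs_distSum_typeSign_le (hz : 0 ≤ z) : |distSum typeSign z G| ≤ distSum 1 z G := by
  have hs : ∀ c, |typeSign c| = 1 := fun c => by cases c <;> simp [typeSign]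
  simp only [distSum, distSumFrom, Pi.one_apply, one_mul]
  refine (Finset.abs_sum_le_sum_abs _ _).trans (Finset.sum_le_sum fun x _ => ?_)
  rw [abs_mul, hs, one_mul]
  refine (Finset.abs_sum_le_sum_abs _ _).trans (Finset.sum_le_sum fun y _ => ?_)
  rw [abs_mul, hs, one_mul, abs_of_nonneg (pow_nonneg hz _)]

end Bounds

/-! ### One step of the growth -/

lemma pexp_coin (q : unitInterval) (f : Bool → ℝ) :
    pexp (coin q) f = q * f true + (1 - q) * f false := by
  have h0 : (0 : ℝ) ≤ q := q.2.1
  have h1 : (0 : ℝ) ≤ 1 - q := sub_nonneg.2 q.2.2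
  simp [pexp, coin, h0, h1]

lemma pexp_parentLaw (q : unitInterval) (n : ℕ) (c : Bool) (f : BCMRTNode (n + 1) → ℝ) :
    pexp (parentLaw q n c) f
      = (∑ p, (1 + typeCorr q * (typeSign c * typeSign p.2)) * f p) / (2 * (n + 1)) := by
  have hu : ∀ g : Fin (n + 1) → ℝ,
      pexp (PMF.uniformOfFintype (Fin (n + 1))) g = (∑ i, g i) / (n + 1) := fun g => by
    simp only [pexp, PMF.uniformOfFintype_apply, Fintype.card_fin, ENNReal.toReal_inv,
      ENNReal.toReal_natCast, ← Finset.mul_sum]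
    push_cast
    rw [div_eq_inv_mul]
  have hn : (n + 1 : ℝ) ≠ 0 := by positivity
  rw [parentLaw, pexp_bind, pexp_coin, pexp_map, pexp_map, hu, hu, Fintype.sum_prod_type]
  simp only [Fintype.sum_bool, Finset.sum_add_distrib, ← Finset.mul_sum]
  cases c <;> simp [typeSign, typeCorr] <;> field_simp <;> ring

/-- A node of each type chooses its parent; together they choose uniformly. -/
lemma pexp_parentLaw_add (q : unitInterval) (n : ℕ) (f : BCMRTNode (n + 1) → ℝ) :
    pexp (parentLaw q n true) f + pexp (parentLaw q n false) f = (∑ p, f p) / (n + 1) := by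
  rw [pexp_parentLaw, pexp_parentLaw, ← add_div, ← Finset.sum_add_distrib,
    ← mul_div_mul_left (∑ p, f p) (n + 1 : ℝ) two_ne_zero, Finset.mul_sum]
  congr 1
  refine Finset.sum_congr rfl fun p _ => ?_
  simp only [typeSign, if_true, Bool.false_eq_true, if_false]
  ring

lemma pexp_parentLaw_sub (q : unitInterval) (n : ℕ) (f : BCMRTNode (n + 1) → ℝ) :
    pexp (parentLaw q n true) f - pexp (parentLaw q n false) f
      = typeCorr q * (∑ p, typeSign p.2 * f p) / (n + 1) := by
  rw [pexp_parentLaw, pexp_parentLaw, ← sub_div, ← Finset.sum_sub_distrib,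
    ← mul_div_mul_left (typeCorr q * _) (n + 1 : ℝ) two_ne_zero, Finset.mul_sum, Finset.mul_sum]
  congr 1
  refine Finset.sum_congr rfl fun p _ => ?_
  simp only [typeSign, if_true, Bool.false_eq_true, if_false]
  ring

/-- The expectation over the parents `u` and `v` of the two nodes added to the tree. -/
noncomputable def parentsExp (q : unitInterval) {n : ℕ}
    (F : BCMRTNode (n + 1) → BCMRTNode (n + 1) → ℝ) : ℝ :=
  pexp (parentLaw q n true) fun u => pexp (parentLaw q n false) fun v => F u v

section ParentsExp

variable (q : unitInterval) {n : ℕ} (F F' : BCMRTNode (n + 1) → BCMRTNode (n + 1) → ℝ)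

lemma parentsExp_add :
    (parentsExp q fun u v => F u v + F' u v) = parentsExp q F + parentsExp q F' := by
  simp only [parentsExp, pexp_add]

lemma parentsExp_const_mul (c : ℝ) :
    (parentsExp q fun u v => c * F u v) = c * parentsExp q F := by
  simp only [parentsExp, pexp_const_mul]

lemma parentsExp_const (c : ℝ) : (parentsExp q (n := n) fun _ _ => c) = c := by
  simp only [parentsExp, pexp_const]

lemma parentsExp_split (f g : BCMRTNode (n + 1) → ℝ) :
    (parentsExp q fun u v => f u + g v)
      = pexp (parentLaw q n true) f + pexp (parentLaw q n false) g := by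
  simp only [parentsExp, pexp_add, pexp_const]

variable {F F'} in
lemma parentsExp_mono (h : ∀ u v, F u v ≤ F' u v) : parentsExp q F ≤ parentsExp q F' :=
  pexp_mono fun u _ => pexp_mono fun v _ => h u v

lemma parentsExp_pow_dist (z : ℝ) (G : SimpleGraph (BCMRTNode (n + 1))) :
    (parentsExp q fun u v => z ^ G.dist u v)
      = (distSum 1 z G - typeCorr q ^ 2 * distSum typeSign z G) / (4 * (n + 1) ^ 2) := by
  have hn : (n + 1 : ℝ) ≠ 0 := by positivity
  set s := typeCorr q
  -- The terms of first order in `s` cancel, since the distance is symmetric.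
  have hsymm : ∑ u : BCMRTNode (n + 1), ∑ v : BCMRTNode (n + 1), typeSign v.2 * z ^ G.dist u v
      = ∑ u : BCMRTNode (n + 1), ∑ v : BCMRTNode (n + 1), typeSign u.2 * z ^ G.dist u v := by
    rw [Finset.sum_comm]
    simp only [SimpleGraph.dist_comm]
  have hexp : ∑ u : BCMRTNode (n + 1), ∑ v : BCMRTNode (n + 1),
      (1 + s * typeSign u.2) * ((1 - s * typeSign v.2) * z ^ G.dist u v)
      = distSum 1 z G - s ^ 2 * distSum typeSign z G := by
    have : ∀ u v : BCMRTNode (n + 1),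
        (1 + s * typeSign u.2) * ((1 - s * typeSign v.2) * z ^ G.dist u v)
        = z ^ G.dist u v + s * (typeSign u.2 * z ^ G.dist u v)
          - s * (typeSign v.2 * z ^ G.dist u v)
          - s ^ 2 * (typeSign u.2 * (typeSign v.2 * z ^ G.dist u v)) := fun u v => by ring
    simp only [this, Finset.sum_add_distrib, Finset.sum_sub_distrib, ← Finset.mul_sum, hsymm,
      distSum, distSumFrom, Pi.one_apply, one_mul]
    ring
  rw [parentsExp]
  simp only [pexp_parentLaw]
  rw [← hexp, eq_div_iff (by positivity), div_mul_eq_mul_div, div_eq_iff (by positivity),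
    Finset.sum_mul, Finset.sum_mul]
  refine Finset.sum_congr rfl fun u _ => ?_
  rw [← Finset.mul_sum]
  simp only [typeSign, if_true, Bool.false_eq_true, if_false]
  rw [show ∀ a b c d : ℝ, a * (b / c) * d = a * b * (d / c) from fun a b c d => by ring,
    show (4 * (n + 1 : ℝ) ^ 2) / (2 * (n + 1)) = 2 * (n + 1) by field_simp; ring]
  congr 2
  · ring
  · exact Finset.sum_congr rfl fun v _ => by ring

end ParentsExp

section Growth

variable (q : unitInterval) {n : ℕ} (z : ℝ) {G : SimpleGraph (BCMRTNode (n + 1))}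

lemma parentsExp_distSum (hG : G.Connected) :
    (parentsExp q fun u v => distSum 1 z (attachPair G u v))
      = distSum 1 z G * (1 + 2 * z / (n + 1)) + 2
        + z ^ 2 / (2 * (n + 1) ^ 2)
          * (distSum 1 z G - typeCorr q ^ 2 * distSum typeSign z G) := by
  have hn : (n + 1 : ℝ) ≠ 0 := by positivity
  have h1 : (parentsExp q fun u v => distSumFrom 1 z G u + distSumFrom 1 z G v)
      = distSum 1 z G / (n + 1) := by
    rw [parentsExp_split, pexp_parentLaw_add]
    simp [distSum]
  simp only [distSum_attachPair 1 z hG, Pi.one_apply, one_mul, parentsExp_add,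
    parentsExp_const_mul, parentsExp_const, parentsExp_pow_dist]
  rw [← parentsExp_add, h1]
  field_simp
  ring

lemma parentsExp_signed_distSum (hG : G.Connected) :
    (parentsExp q fun u v => distSum typeSign z (attachPair G u v))
      = distSum typeSign z G * (1 + 2 * z * typeCorr q / (n + 1)) + 2
        - z ^ 2 / (2 * (n + 1) ^ 2)
          * (distSum 1 z G - typeCorr q ^ 2 * distSum typeSign z G) := by
  have hn : (n + 1 : ℝ) ≠ 0 := by positivity
  have ht : typeSign true = 1 := rfl
  have hf : typeSign false = -1 := rfl
  have h1 : (parentsExp q fun u v => distSumFrom typeSign z G u + -1 * distSumFrom typeSign z G v)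
      = typeCorr q * distSum typeSign z G / (n + 1) := by
    rw [parentsExp_split, pexp_const_mul, neg_one_mul, ← sub_eq_add_neg, pexp_parentLaw_sub,
      distSum]
  simp only [distSum_attachPair typeSign z hG, ht, hf, one_mul, parentsExp_add,
    parentsExp_const_mul, parentsExp_const, parentsExp_pow_dist]
  rw [← parentsExp_const_mul, ← parentsExp_add, h1]
  field_simp
  ring

end Growth

/-! ### The growth of the expectations -/

lemma bcmrt_connected (q : unitInterval) (n : ℕ) :
    ∀ G ∈ (bcmrt q (n + 1)).support, G.Connected := by
  induction n with
  | zero =>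
    intro G hG
    simp only [bcmrt, PMF.support_pure, Set.mem_singleton_iff] at hG
    subst hG
    have hadj : (SimpleGraph.edge ((0 : Fin 1), true) (0, false)).Adj (0, true) (0, false) := by
      simp [SimpleGraph.edge_adj]
    have key : ∀ x, (SimpleGraph.edge ((0 : Fin 1), true) (0, false)).Reachable x (0, true) := by
      rintro ⟨i, c⟩
      obtain rfl : i = 0 := Subsingleton.elim _ _
      cases c
      · exact hadj.symm.reachable
      · rfl
    have : Nonempty (BCMRTNode 1) := ⟨(0, true)⟩
    exact ⟨fun x y => (key x).trans (key y).symm⟩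
  | succ n ih =>
    intro G hG
    simp only [bcmrt, PMF.mem_support_bind_iff, PMF.mem_support_map_iff] at hG
    obtain ⟨G', hG', u, -, v, -, rfl⟩ := hG
    exact attachPair_connected (ih G' hG')

lemma pexp_bcmrt_succ (q : unitInterval) (n : ℕ) (F : SimpleGraph (BCMRTNode (n + 2)) → ℝ) :
    pexp (bcmrt q (n + 2)) F
      = pexp (bcmrt q (n + 1)) fun G => parentsExp q fun u v => F (attachPair G u v) := by
  simp only [bcmrt, parentsExp, pexp_bind, pexp_map]

lemma distSum_edge (ε : Bool → ℝ) (z : ℝ) :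
    distSum ε z (SimpleGraph.edge ((0 : Fin 1), true) (0, false))
      = ε true ^ 2 + ε false ^ 2 + 2 * z * (ε true * ε false) := by
  have h : (SimpleGraph.edge ((0 : Fin 1), true) (0, false)).dist (0, true) (0, false) = 1 := by
    rw [SimpleGraph.dist_eq_one_iff_adj]
    simp [SimpleGraph.edge_adj]
  have h' := h
  rw [SimpleGraph.dist_comm] at h'
  simp [distSum, distSumFrom, Fintype.sum_prod_type, h, h']
  ring

/-- The expected sum of `z ^ d(x, y)` in the tree with `2 * (n + 1)` nodes. -/
noncomputable def meanDistSum (q : unitInterval) (z : ℝ) (n : ℕ) : ℝ :=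
  pexp (bcmrt q (n + 1)) (distSum 1 z)

/-- The expectation of the sum of `z ^ d(x, y)` over pairs of different types, minus that over
pairs of the same type (equal nodes included), in the tree with `2 * (n + 1)` nodes. -/
noncomputable def meanCrossExcess (q : unitInterval) (z : ℝ) (n : ℕ) : ℝ :=
  -pexp (bcmrt q (n + 1)) (distSum typeSign z)

lemma meanDistSum_zero (q : unitInterval) (z : ℝ) : meanDistSum q z 0 = 2 + 2 * z := by
  rw [meanDistSum, zero_add, bcmrt, pexp_pure, distSum_edge]
  norm_num

lemma meanCrossExcess_zero (q : unitInterval) (z : ℝ) : meanCrossExcess q z 0 = 2 * z - 2 := by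
  rw [meanCrossExcess, zero_add, bcmrt, pexp_pure, distSum_edge]
  simp [typeSign]
  ring

lemma meanDistSum_succ (q : unitInterval) (z : ℝ) (n : ℕ) :
    meanDistSum q z (n + 1) = meanDistSum q z n * (1 + 2 * z / (n + 1)) + 2
      + z ^ 2 / (2 * (n + 1) ^ 2) * (meanDistSum q z n + typeCorr q ^ 2 * meanCrossExcess q z n) := by
  rw [meanDistSum, pexp_bcmrt_succ,
    pexp_congr fun G hG => parentsExp_distSum q z (bcmrt_connected q n G hG)]
  simp only [mul_comm (distSum 1 z _) (1 + _), pexp_add, pexp_const_mul, pexp_sub, pexp_const]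
  rw [meanDistSum, meanCrossExcess]
  ring

lemma meanCrossExcess_succ (q : unitInterval) (z : ℝ) (n : ℕ) :
    meanCrossExcess q z (n + 1) = meanCrossExcess q z n * (1 + 2 * z * typeCorr q / (n + 1)) - 2
      + z ^ 2 / (2 * (n + 1) ^ 2) * (meanDistSum q z n + typeCorr q ^ 2 * meanCrossExcess q z n) := by
  rw [meanCrossExcess, pexp_bcmrt_succ,
    pexp_congr fun G hG => parentsExp_signed_distSum q z (bcmrt_connected q n G hG)]
  simp only [mul_comm (distSum typeSign z _) (1 + _), pexp_add, pexp_const_mul, pexp_sub,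
    pexp_const]
  rw [meanDistSum, meanCrossExcess]
  ring

lemma sq_le_meanDistSum (q : unitInterval) {z : ℝ} (hz : 1 ≤ z) (n : ℕ) :
    4 * (n + 1 : ℝ) ^ 2 ≤ meanDistSum q z n := by
  rw [meanDistSum, ← pexp_const (bcmrt q (n + 1)) (4 * (n + 1 : ℝ) ^ 2)]
  exact pexp_mono fun G _ => by exact_mod_cast sq_le_distSum G hz

-- Unification must not unfold these expectations down to the recursion for `bcmrt`.
attribute [irreducible] meanDistSum meanCrossExcess

/-! ### The gap between the means -/

lemma typeCorr_sq_le_one (q : unitInterval) : typeCorr q ^ 2 ≤ 1 := by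
  have h0 := q.2.1
  have h1 := q.2.2
  rw [sq_le_one_iff_abs_le_one, typeCorr, abs_le]
  constructor <;> linarith

/-- The only negative term of the recursion, `-2`, counts each new node paired with itself. The two
new nodes paired with each other outweigh it, since `distSum 1 z` is at least the number of ordered
pairs. -/
lemma meanCrossExcess_nonneg {q : unitInterval} (hq : 0 ≤ typeCorr q) {z : ℝ} (hz : 1 ≤ z)
    (n : ℕ) : 0 ≤ meanCrossExcess q z n := by
  induction n with
  | zero => rw [meanCrossExcess_zero]; linarith
  | succ n ih =>
    have hT := sq_le_meanDistSum q hz n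
    have hN : (0 : ℝ) < n + 1 := by positivity
    have h1 : 2 * z ^ 2 ≤ z ^ 2 / (2 * (n + 1) ^ 2) * meanDistSum q z n := by
      calc 2 * z ^ 2 = z ^ 2 / (2 * (n + 1) ^ 2) * (4 * (n + 1 : ℝ) ^ 2) := by field_simp; ring
        _ ≤ _ := by gcongr
    have h2 : 1 ≤ z ^ 2 := one_le_pow₀ hz
    have h3 : 0 ≤ z ^ 2 / (2 * (n + 1 : ℝ) ^ 2) * (typeCorr q ^ 2 * meanCrossExcess q z n) := by
      positivity
    have h4 : 0 ≤ meanCrossExcess q z n * (1 + 2 * z * typeCorr q / (n + 1)) := by positivity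
    rw [meanCrossExcess_succ, mul_add]
    linarith

lemma meanCrossExcess_le (q : unitInterval) {z : ℝ} (hz : 0 ≤ z) (n : ℕ) :
    meanCrossExcess q z n ≤ meanDistSum q z n := by
  rw [meanCrossExcess, meanDistSum, ← neg_one_mul, ← pexp_const_mul]
  refine pexp_mono fun G _ => ?_
  linarith [neg_abs_le (distSum typeSign z G), abs_distSum_typeSign_le G hz]

section Gap

variable {q₀ q₁ : unitInterval} {z : ℝ}

/-- Both means increase with the correlation of the types. -/
lemma means_mono (h₁ : 0 ≤ typeCorr q₁) (h : typeCorr q₁ ≤ typeCorr q₀) (hz : 1 ≤ z) (n : ℕ) :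
    meanCrossExcess q₁ z n ≤ meanCrossExcess q₀ z n ∧ meanDistSum q₁ z n ≤ meanDistSum q₀ z n := by
  induction n with
  | zero => simp [meanCrossExcess_zero, meanDistSum_zero]
  | succ n ih =>
    have hX₁ := meanCrossExcess_nonneg h₁ hz n
    have hz0 : 0 ≤ z := by linarith
    have hT₁ : 0 ≤ meanDistSum q₁ z n := hX₁.trans (meanCrossExcess_le q₁ hz0 n)
    have h₀ := h₁.trans h
    have hX₀ := hX₁.trans ih.1
    rw [meanCrossExcess_succ, meanCrossExcess_succ, meanDistSum_succ, meanDistSum_succ]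
    have hi := ih.1
    have hi' := ih.2
    constructor <;> gcongr

lemma meanDistSum_gap_succ (h₁ : 0 ≤ typeCorr q₁) (h : typeCorr q₁ ≤ typeCorr q₀) (hz : 1 ≤ z)
    (n : ℕ) : (meanDistSum q₀ z n - meanDistSum q₁ z n) * (1 + 2 * z / (n + 1))
      ≤ meanDistSum q₀ z (n + 1) - meanDistSum q₁ z (n + 1) := by
  obtain ⟨hX, hT⟩ := means_mono h₁ h hz n
  have hX₁ := meanCrossExcess_nonneg h₁ hz n
  have hX₀ := hX₁.trans hX
  have : z ^ 2 / (2 * (n + 1) ^ 2) * (meanDistSum q₁ z n + typeCorr q₁ ^ 2 * meanCrossExcess q₁ z n)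
      ≤ z ^ 2 / (2 * (n + 1) ^ 2)
        * (meanDistSum q₀ z n + typeCorr q₀ ^ 2 * meanCrossExcess q₀ z n) := by
    gcongr
  rw [meanDistSum_succ, meanDistSum_succ]
  linarith

/-- The gap appears once there are four nodes, and then grows at least like the cube of the size. -/
lemma cube_le_meanDistSum_gap (h₁ : 0 ≤ typeCorr q₁) (h : typeCorr q₁ ≤ typeCorr q₀) (n : ℕ) :
    9 / 8 * (typeCorr q₀ ^ 2 - typeCorr q₁ ^ 2) / 24 * (n + 2) ^ 3
      ≤ meanDistSum q₀ (3 / 2) (n + 1) - meanDistSum q₁ (3 / 2) (n + 1) := by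
  set γ := 9 / 8 * (typeCorr q₀ ^ 2 - typeCorr q₁ ^ 2) with hγ
  have hγ0 : 0 ≤ γ := by
    have : typeCorr q₁ ^ 2 ≤ typeCorr q₀ ^ 2 := by gcongr
    rw [hγ]
    linarith
  -- A rising factorial instead of the cube makes the growth factor exactly `1 + 3 / (n + 2)`.
  have key : γ / 24 * ((n + 2) * (n + 3) * (n + 4))
      ≤ meanDistSum q₀ (3 / 2) (n + 1) - meanDistSum q₁ (3 / 2) (n + 1) := by
    induction n with
    | zero =>
      rw [meanDistSum_succ, meanDistSum_succ]
      simp only [meanDistSum_zero, meanCrossExcess_zero, Nat.cast_zero]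
      rw [hγ]
      linarith
    | succ n ih =>
      refine le_trans (le_of_eq ?_) ((mul_le_mul_of_nonneg_right ih ?_).trans
        (meanDistSum_gap_succ h₁ h (by norm_num) (n + 1)))
      · push_cast
        field_simp
        ring
      · positivity
  refine le_trans ?_ key
  have hn : (0 : ℝ) ≤ n := n.cast_nonneg
  have : (n + 2 : ℝ) ^ 3 ≤ (n + 2) * (n + 3) * (n + 4) := by nlinarith
  gcongr

end Gap

/-! ### Second moments -/

lemma meanDistSum_succ_le (q : unitInterval) (n : ℕ) :
    meanDistSum q (9 / 4) (n + 1) ≤ meanDistSum q (9 / 4) n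
      * (1 + 9 / 2 * (n + 1 : ℝ)⁻¹ + 6 * (n + 1 : ℝ)⁻¹ ^ 2) := by
  have hN : (0 : ℝ) < n + 1 := by positivity
  set t := (n + 1 : ℝ)⁻¹ with ht
  have hT := sq_le_meanDistSum q (z := 9 / 4) (by norm_num) n
  have hX := meanCrossExcess_le q (z := 9 / 4) (by norm_num) n
  have h5 : meanDistSum q (9 / 4) (n + 1) = meanDistSum q (9 / 4) n * (1 + 9 / 2 * t) + 2
      + 81 / 32 * (t ^ 2
        * (meanDistSum q (9 / 4) n + typeCorr q ^ 2 * meanCrossExcess q (9 / 4) n)) := by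
    rw [meanDistSum_succ, ht]
    field_simp
    ring
  set T := meanDistSum q (9 / 4) n
  set X := meanCrossExcess q (9 / 4) n
  have hT0 : 0 ≤ T := le_trans (by positivity) hT
  have h2 : 4 ≤ T * t ^ 2 := by
    rw [ht, inv_pow, ← div_eq_mul_inv, le_div_iff₀ (by positivity)]
    exact hT
  have h3 : typeCorr q ^ 2 * X ≤ T := by
    have := typeCorr_sq_le_one q
    have := sq_nonneg (typeCorr q)
    nlinarith
  have h4 : t ^ 2 * (T + typeCorr q ^ 2 * X) ≤ t ^ 2 * (T + T) := by gcongr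
  rw [h5]
  nlinarith

/-- The increment of the statistic is at most `9` times the sum over the parents `u` and `v` of
`distSumFrom`, whose second moment is controlled by the statistic with base `9 / 4 = (3 / 2) ^ 2`. -/
lemma parentsExp_distSum_sq_le (q : unitInterval) {n : ℕ} {G : SimpleGraph (BCMRTNode (n + 1))}
    (hG : G.Connected) :
    (parentsExp q fun u v => distSum 1 (3 / 2) (attachPair G u v) ^ 2)
      ≤ (1 + 6 * (n + 1 : ℝ)⁻¹ + 11 / 2 * (n + 1 : ℝ)⁻¹ ^ 2) * distSum 1 (3 / 2) G ^ 2
        + 324 * distSum 1 (9 / 4) G := by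
  have hN : (0 : ℝ) < n + 1 := by positivity
  set t := (n + 1 : ℝ)⁻¹ with ht
  set T := distSum 1 (3 / 2) G with hTdef
  have hT : 4 * (n + 1 : ℝ) ^ 2 ≤ T := by
    exact_mod_cast sq_le_distSum G (z := 3 / 2) (by norm_num)
  have hT0 : 0 ≤ T := le_trans (by positivity) hT
  have hmean : (parentsExp q fun u v => distSum 1 (3 / 2) (attachPair G u v))
      ≤ T * (1 + 3 * t + 11 / 4 * t ^ 2) := by
    have h2 : 4 ≤ T * t ^ 2 := by
      rw [ht, inv_pow, ← div_eq_mul_inv, le_div_iff₀ (by positivity)]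
      exact hT
    have h3 : -(typeCorr q ^ 2 * distSum typeSign (3 / 2) G) ≤ T := by
      have h4 := typeCorr_sq_le_one q
      have h5 := sq_nonneg (typeCorr q)
      have h6 := abs_distSum_typeSign_le G (z := 3 / 2) (by norm_num)
      have h7 := neg_abs_le (distSum typeSign (3 / 2) G)
      nlinarith
    have h4 : t ^ 2 * (T - typeCorr q ^ 2 * distSum typeSign (3 / 2) G) ≤ t ^ 2 * (T + T) := by
      gcongr
      linarith
    have h5 : (parentsExp q fun u v => distSum 1 (3 / 2) (attachPair G u v)) = T * (1 + 3 * t) + 2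
        + 9 / 8 * (t ^ 2 * (T - typeCorr q ^ 2 * distSum typeSign (3 / 2) G)) := by
      rw [parentsExp_distSum q _ hG, ht, ← hTdef]
      field_simp
      ring
    rw [h5]
    nlinarith
  have hpt : ∀ u v, distSum 1 (3 / 2) (attachPair G u v) ^ 2
      ≤ (2 * T * distSum 1 (3 / 2) (attachPair G u v) + -T ^ 2)
        + 324 * (n + 1) * (distSumFrom 1 (9 / 4) G u + distSumFrom 1 (9 / 4) G v) := fun u v => by
    have hu := two_mul_le_distSumFrom G (z := 3 / 2) (by norm_num) u
    have hv := two_mul_le_distSumFrom G (z := 3 / 2) (by norm_num) v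
    have huv := pow_dist_le_distSumFrom G (z := 3 / 2) (by norm_num) u v
    have hf : (0 : ℝ) ≤ (3 / 2 : ℝ) ^ G.dist u v := by positivity
    have hu2 := distSumFrom_sq_le G (3 / 2) u
    have hv2 := distSumFrom_sq_le G (3 / 2) v
    have hinc := distSum_attachPair 1 (3 / 2) hG u v
    rw [show (3 / 2 : ℝ) ^ 2 = 9 / 4 by norm_num] at hu2 hv2
    simp only [Pi.one_apply, one_mul, mul_one] at hinc
    rw [← hTdef] at hinc
    push_cast at hu hv hu2 hv2
    have hn0 : (0 : ℝ) ≤ n := n.cast_nonneg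
    set a := distSumFrom 1 (3 / 2) G u
    set b := distSumFrom 1 (3 / 2) G v
    set T' := distSum 1 (3 / 2) (attachPair G u v)
    have hI0 : 0 ≤ T' - T := by rw [hinc]; linarith
    have hI : T' - T ≤ 9 * (a + b) := by rw [hinc]; linarith
    have hI2 : (T' - T) ^ 2 ≤ (9 * (a + b)) ^ 2 := by gcongr
    have hab : (a + b) ^ 2 ≤ 2 * (a ^ 2 + b ^ 2) := by nlinarith [sq_nonneg (a - b)]
    nlinarith
  refine (parentsExp_mono q hpt).trans ?_
  rw [parentsExp_add, parentsExp_add, parentsExp_const, parentsExp_const_mul, parentsExp_const_mul,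
    parentsExp_split, pexp_parentLaw_add]
  have hY : 324 * (n + 1 : ℝ) * ((∑ p, distSumFrom 1 (9 / 4) G p) / (n + 1))
      = 324 * distSum 1 (9 / 4) G := by
    rw [mul_assoc, mul_div_cancel₀ _ hN.ne']
    simp [distSum]
  have h6 := mul_le_mul_of_nonneg_left hmean (mul_nonneg zero_le_two hT0)
  rw [hY]
  linarith

/-- The second moment of the statistic has the order of the sixth power of the size. The summand
with base `9 / 4` makes the bound inductive: it absorbs the second moments of the increments. -/
lemma second_moment_add_le (q : unitInterval) (n : ℕ) :
    (pexp (bcmrt q (n + 1)) fun G => distSum 1 (3 / 2) G ^ 2)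
      + 648 * (n + 1) * meanDistSum q (9 / 4) n ≤ 4237 * (n + 1) ^ 6 := by
  induction n with
  | zero =>
    rw [meanDistSum_zero, zero_add, bcmrt, pexp_pure, distSum_edge]
    norm_num
  | succ n ih =>
    have hN : (0 : ℝ) < n + 1 := by positivity
    have h1 : (pexp (bcmrt q (n + 2)) fun G => distSum 1 (3 / 2) G ^ 2)
        ≤ (1 + 6 * (n + 1 : ℝ)⁻¹ + 11 / 2 * (n + 1 : ℝ)⁻¹ ^ 2)
          * (pexp (bcmrt q (n + 1)) fun G => distSum 1 (3 / 2) G ^ 2)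
          + 324 * meanDistSum q (9 / 4) n := by
      rw [pexp_bcmrt_succ, meanDistSum, ← pexp_const_mul, ← pexp_const_mul, ← pexp_add]
      exact pexp_mono fun G hG => parentsExp_distSum_sq_le q (bcmrt_connected q n G hG)
    have h2 := meanDistSum_succ_le q n
    have ha : 0 ≤ pexp (bcmrt q (n + 1)) fun G => distSum 1 (3 / 2) G ^ 2 := by
      rw [← pexp_const (bcmrt q (n + 1)) 0]
      exact pexp_mono fun G _ => sq_nonneg _
    have hy : 0 ≤ meanDistSum q (9 / 4) n :=
      le_trans (by positivity) (sq_le_meanDistSum q (z := 9 / 4) (by norm_num) n)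
    set a := pexp (bcmrt q (n + 1)) fun G => distSum 1 (3 / 2) G ^ 2
    set y := meanDistSum q (9 / 4) n
    set t := (n + 1 : ℝ)⁻¹ with ht
    have ht0 : 0 ≤ t := by positivity
    clear_value a y
    have hNt : (n + 1 : ℝ) * t = 1 := mul_inv_cancel₀ hN.ne'
    have hN1 : ((n + 1 : ℕ) : ℝ) + 1 = (n + 1) * (1 + t) := by
      rw [mul_add, hNt]
      push_cast
      ring
    have hca : 1 + 6 * t + 11 / 2 * t ^ 2 ≤ (1 + t) ^ 6 := by
      rw [← sub_nonneg]
      ring_nf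
      positivity
    have hcy : 1 / 2 * t + (1 + t) * (1 + 9 / 2 * t + 6 * t ^ 2) ≤ (1 + t) ^ 6 := by
      rw [← sub_nonneg]
      ring_nf
      positivity
    rw [hN1]
    calc _ ≤ ((1 + 6 * t + 11 / 2 * t ^ 2) * a + 324 * y)
          + 648 * ((n + 1) * (1 + t)) * (y * (1 + 9 / 2 * t + 6 * t ^ 2)) := by
          gcongr
      _ = (1 + 6 * t + 11 / 2 * t ^ 2) * a + 648 * (n + 1) * y
          * (1 / 2 * t + (1 + t) * (1 + 9 / 2 * t + 6 * t ^ 2)) := by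
          linear_combination (-324 * y) * hNt
      _ ≤ (1 + t) ^ 6 * a + 648 * (n + 1) * y * (1 + t) ^ 6 := by gcongr
      _ = (1 + t) ^ 6 * (a + 648 * (n + 1) * y) := by ring
      _ ≤ (1 + t) ^ 6 * (4237 * (n + 1) ^ 6) := by gcongr
      _ = _ := by ring

lemma second_moment_le (q : unitInterval) (n : ℕ) :
    (pexp (bcmrt q (n + 1)) fun G => distSum 1 (3 / 2) G ^ 2) ≤ 4237 * (n + 1) ^ 6 := by
  have hy : 0 ≤ meanDistSum q (9 / 4) n :=
    le_trans (by positivity) (sq_le_meanDistSum q (z := 9 / 4) (by norm_num) n)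
  have : 0 ≤ 648 * (n + 1) * meanDistSum q (9 / 4) n := by positivity
  linarith [second_moment_add_le q n]

/-! ### Testing -/

instance Shape.instFinite (n : ℕ) : Finite (Shape n) :=
  inferInstanceAs (Finite (Quotient (shapeSetoid n)))

noncomputable instance Shape.instFintype (n : ℕ) : Fintype (Shape n) := Fintype.ofFinite _

/-- The sum of `(3 / 2) ^ d(x, y)` over the ordered pairs of nodes of an unlabelled tree. -/
noncomputable def Shape.distSum {n : ℕ} : Shape n → ℝ :=
  Quotient.lift (_root_.distSum 1 (3 / 2)) fun _ _ ⟨e⟩ => distSum_eq_of_iso _ e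

/-- For `q₀ < q₁ ≤ 1 / 2`, events of the unlabelled trees separate the two laws uniformly. -/
lemma exists_uniform_separation {q₀ q₁ : unitInterval} (hlt : q₀ < q₁) (hhalf : (q₁ : ℝ) ≤ 1 / 2) :
    ∃ c : ℝ, 0 < c ∧ ∀ n : ℕ, 2 ≤ n → ∃ E : Set (Shape n),
      c ≤ eventProb (unlabelledBCMRT q₀ n) E - eventProb (unlabelledBCMRT q₁ n) E := by
  have hlt' : (q₀ : ℝ) < q₁ := hlt
  have h₁ : 0 ≤ typeCorr q₁ := by rw [typeCorr]; linarith
  have h : typeCorr q₁ < typeCorr q₀ := by rw [typeCorr, typeCorr]; linarith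
  set γ := 9 / 8 * (typeCorr q₀ ^ 2 - typeCorr q₁ ^ 2) / 24 with hγ
  have hγ0 : 0 < γ := by
    have : typeCorr q₁ ^ 2 < typeCorr q₀ ^ 2 := by gcongr
    rw [hγ]
    linarith
  refine ⟨γ ^ 2 / 16948, by positivity, fun n hn => ?_⟩
  obtain ⟨n, rfl⟩ := Nat.exists_eq_add_of_le' hn
  have hmap : ∀ q, ∀ f : ℝ → ℝ, (pexp (unlabelledBCMRT q (n + 2)) fun T => f T.distSum)
      = pexp (bcmrt q (n + 2)) fun G => f (distSum 1 (3 / 2) G) := fun q f =>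
    @pexp_map _ _ _ (Shape.instFintype (n + 2)) _ _ _
  obtain ⟨E, hE⟩ := exists_event_separation (unlabelledBCMRT q₀ (n + 2))
    (unlabelledBCMRT q₁ (n + 2)) Shape.distSum
  refine ⟨E, ?_⟩
  have hgap := cube_le_meanDistSum_gap h₁ h.le n
  rw [← hγ] at hgap
  have hm := fun q => hmap q id
  have hsq := fun q => hmap q fun x => x ^ 2
  simp only [id] at hm
  rw [hm, hm, hsq, hsq] at hE
  have hs : ∀ q, (pexp (bcmrt q (n + 2)) fun G => distSum 1 (3 / 2) G ^ 2)
      ≤ 4237 * (n + 2 : ℝ) ^ 6 := fun q => by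
    have := second_moment_le q (n + 1)
    rw [show ((n + 1 : ℕ) : ℝ) + 1 = n + 2 by push_cast; ring] at this
    exact this
  have hgap2 : (γ * (n + 2) ^ 3) ^ 2 ≤ (meanDistSum q₀ (3 / 2) (n + 1)
      - meanDistSum q₁ (3 / 2) (n + 1)) ^ 2 := by gcongr
  rw [meanDistSum, meanDistSum] at hgap2
  set Δ := eventProb (unlabelledBCMRT q₀ (n + 2)) E - eventProb (unlabelledBCMRT q₁ (n + 2)) E
  have hchain := hgap2.trans hE
  have ha0 : ∀ q, 0 ≤ pexp (bcmrt q (n + 2)) fun G => distSum 1 (3 / 2) G ^ 2 := fun q => by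
    rw [← pexp_const (bcmrt q (n + 2)) 0]
    exact pexp_mono fun G _ => sq_nonneg _
  have hΔ : 0 ≤ Δ := by
    have hpos : 0 < (γ * (n + 2 : ℝ) ^ 3) ^ 2 := by positivity
    refine (pos_of_mul_pos_right (hpos.trans_le hchain) ?_).le
    linarith [ha0 q₀, ha0 q₁]
  have hbound := hchain.trans (mul_le_mul_of_nonneg_right
    (show _ ≤ 16948 * (n + 2 : ℝ) ^ 6 by linarith [hs q₀, hs q₁]) hΔ)
  have hn6 : (0 : ℝ) < (n + 2) ^ 6 := by positivity
  rw [div_le_iff₀ (by norm_num), ← mul_le_mul_iff_left₀ hn6]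
  calc _ = (γ * (n + 2 : ℝ) ^ 3) ^ 2 := by ring
    _ ≤ _ := hbound
    _ = _ := by ring

lemma optimalRisk_le {q₀ q₁ : unitInterval} {n : ℕ} (E : Set (Shape n)) :
    optimalRisk q₀ q₁ n ≤ 1 / 2
      - (eventProb (unlabelledBCMRT q₀ n) E - eventProb (unlabelledBCMRT q₁ n) E) / 2 := by
  classical
  have hbdd : BddBelow (Set.range fun φ : Shape n → Bool => risk q₀ q₁ n φ) := by
    refine ⟨0, ?_⟩
    rintro _ ⟨φ, rfl⟩
    exact mul_nonneg (by norm_num) (add_nonneg (eventProb_nonneg _ _) (eventProb_nonneg _ _))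
  refine (ciInf_le hbdd fun T => decide (T ∉ E)).trans (le_of_eq ?_)
  have h1 : {T : Shape n | decide (T ∉ E) = true} = Eᶜ := by ext; simp
  have h2 : {T : Shape n | decide (T ∉ E) = false} = E := by ext; simp
  rw [risk, h1, h2]
  linarith [eventProb_add_compl (unlabelledBCMRT q₀ n) E]

lemma sub_le_tvDist {α : Type*} [Fintype α] (p q : PMF α) (E : Set α) :
    eventProb p E - eventProb q E ≤ tvDist p q := by
  have hbdd : BddAbove (Set.range fun E : Set α => |eventProb p E - eventProb q E|) := by
    refine ⟨1, ?_⟩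
    rintro _ ⟨E, rfl⟩
    rw [abs_le]
    constructor <;>
      linarith [eventProb_nonneg p E, eventProb_nonneg q E, eventProb_le_one p E,
        eventProb_le_one q E]
  exact (le_abs_self _).trans (le_ciSup hbdd E)

theorem mainTheorem1 (q₀ q₁ : unitInterval) (hlt : q₀ < q₁) (hhalf : (q₁ : ℝ) ≤ 1 / 2) :
    (BddAbove (Set.range fun n : {n : ℕ // 2 ≤ n} => optimalRisk q₀ q₁ n) ∧
      (⨆ n : {n : ℕ // 2 ≤ n}, optimalRisk q₀ q₁ n) < 1 / 2) ∧
    0 < (⨅ n : {n : ℕ // 2 ≤ n}, tvDist (unlabelledBCMRT q₀ n) (unlabelledBCMRT q₁ n)) := by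
  obtain ⟨c, hc, hsep⟩ := exists_uniform_separation hlt hhalf
  have : Nonempty {n : ℕ // 2 ≤ n} := ⟨⟨2, le_rfl⟩⟩
  have hrisk : ∀ n : {n : ℕ // 2 ≤ n}, optimalRisk q₀ q₁ n ≤ 1 / 2 - c / 2 := fun n => by
    obtain ⟨E, hE⟩ := hsep n n.2
    linarith [optimalRisk_le (q₀ := q₀) (q₁ := q₁) E]
  refine ⟨⟨⟨1 / 2 - c / 2, ?_⟩, (ciSup_le hrisk).trans_lt (by linarith)⟩, ?_⟩
  · rintro _ ⟨n, rfl⟩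
    exact hrisk n
  · refine hc.trans_le (le_ciInf fun n => ?_)
    obtain ⟨E, hE⟩ := hsep n n.2
    exact hE.trans (sub_le_tvDist _ _ E)
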